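/- Consider four bodies of masses $1,m,m,1$ ($m>0$) on a line, at the positions $x_1\ge x_2\ge -x_2\ge -x_1$, moving under Newtonian gravity $$\ddot x_1=-\frac1{4x_1^2}-\frac m{(x_1+x_2)^2}-\frac m{(x_1-x_2)^2},\qquad \ddot x_2=-\frac m{4x_2^2}-\frac1{(x_1+x_2)^2}+\frac1{(x_1-x_2)^2},$$ with total energy $-1$. In the regularized variables, where $x_1=Q_1^2+\tfrac12Q_2^2$, $x_2=\tfrac12Q_2^2$ and $dt/ds=Q_1^2Q_2^2$ (with $t=0$ at $s=0$), the motion is governed by Hamilton's equations $Q_i'=\partial\Gamma/\partial P_i$, $P_i'=-\partial\Gamma/\partial Q_i$ ($'=d/ds$) of $$\Gamma=\frac{Q_2^2P_1^2}{16}+\frac{Q_2^2P_1^2-4Q_1Q_2P_1P_2+4Q_1^2P_2^2}{16m}-m^2Q_1^2-2mQ_2^2-\frac{2mQ_1^2Q_2^2}{Q_1^2+Q_2^2}-\frac{Q_1^2Q_2^2}{2Q_1^2+Q_2^2}+Q_1^2Q_2^2$$ on $(Q_1,Q_2)\neq(0,0)$. Let $R>0$ and consider the solution that starts at a binary collision of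 the inner pair: $$Q_1(0)=R,\quad Q_2(0)=0,\quad P_1(0)=0,\quad P_2(0)=2m^{3/2}.$$ Suppose that it exists up to some time $s_1>0$, that $s_1$ is the time of the first simultaneous binary collision, i.e. $Q_1(s_1)=0$ and $Q_1\ne0$ on $[0,s_1)$, and that $Q_2>0$ on $(0,s_1]$ (no further binary collision of the inner pair up to $s_1$). If $P_2(s_1)=0$, then: 1. The solution exists for all $s\in\mathbb R$, is unique (any solution on an interval containing $0$ with the same initial values agrees with it there), and is periodic with least period $4s_1$. 2. Along it, binary collisions of the inner pair ($x_2=0<x_1$) occur exactly at $s=2ks_1$, and simultaneous binary collisions ($x_1=x_2>0$) exactly at $s=(2k+1)s_1$, $k\in\mathbb Z$; so the two kinds of collision alternate. 3. Hence it is a Schubart-like periodic orbit: $s\mapsto t(s)$ is an increasing bijection of $\mathbb R$, and as functions of the physical time $t$ the positions $x_1,x_2$ are continuous with $0\le x_2\le x_1$ and $x_1>0$, have least period $T=2t(s_1)$, satisfy Newton's equations with total energy $-1$ away from collisions, and have inner binary collisions exactly at the times $t=kT$ and simultaneous binary collisions exactly at $t=t(s_1)+kT$, $k\in\mathbb Z$.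 -/

import Mathlib

open Set Filter Topology

noncomputable section

namespace CollinearFourBody

/-- The regularized Hamiltonian `Γ = (dt/ds) (H - E)` of the symmetric collinear four-body problem
with masses `1, m, m, 1`, as a function of the regularized coordinates `Q₁, Q₂` and their conjugate
momenta `P₁, P₂`; `E` is the total energy. It is used off `Q₁ = Q₂ = 0` (total collision). -/
def regHam (m E Q₁ Q₂ P₁ P₂ : ℝ) : ℝ :=
  1 / 16 * Q₂ ^ 2 * P₁ ^ 2
    + (Q₂ ^ 2 * P₁ ^ 2 - 4 * Q₁ * Q₂ * P₁ * P₂ + 4 * Q₁ ^ 2 * P₂ ^ 2) / (16 * m)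
    - m ^ 2 * Q₁ ^ 2 - 2 * m * Q₂ ^ 2
    - 2 * m * Q₁ ^ 2 * Q₂ ^ 2 / (Q₁ ^ 2 + Q₂ ^ 2)
    - Q₁ ^ 2 * Q₂ ^ 2 / (2 * Q₁ ^ 2 + Q₂ ^ 2)
    - Q₁ ^ 2 * Q₂ ^ 2 * E

/-- A curve in the regularized phase space, given by its four coordinate functions of the
regularized time `s`. -/
structure PhaseCurve where
  /-- first coordinate -/
  Q₁ : ℝ → ℝ
  /-- second coordinate -/
  Q₂ : ℝ → ℝ
  /-- momentum conjugate to the first coordinate -/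
  P₁ : ℝ → ℝ
  /-- momentum conjugate to the second coordinate -/
  P₂ : ℝ → ℝ

namespace PhaseCurve

/-- The point of phase space reached at regularized time `s`. -/
def state (z : PhaseCurve) (s : ℝ) : ℝ × ℝ × ℝ × ℝ := (z.Q₁ s, z.Q₂ s, z.P₁ s, z.P₂ s)

/-- The curve solves Hamilton's equations of `Γ`, with total energy `E = -1`, on the set `I` of
regularized times (one-sided derivatives at end points of `I`), inside the domain
`(Q₁, Q₂) ≠ (0, 0)` of `Γ`. -/
structure IsSolutionOn (z : PhaseCurve) (m : ℝ) (I : Set ℝ) : Prop where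
  mem_domain : ∀ s ∈ I, z.Q₁ s ≠ 0 ∨ z.Q₂ s ≠ 0
  hQ₁ : ∀ s ∈ I, HasDerivWithinAt z.Q₁
    (deriv (fun p => regHam m (-1) (z.Q₁ s) (z.Q₂ s) p (z.P₂ s)) (z.P₁ s)) I s
  hQ₂ : ∀ s ∈ I, HasDerivWithinAt z.Q₂
    (deriv (fun p => regHam m (-1) (z.Q₁ s) (z.Q₂ s) (z.P₁ s) p) (z.P₂ s)) I s
  hP₁ : ∀ s ∈ I, HasDerivWithinAt z.P₁
    (-deriv (fun q => regHam m (-1) q (z.Q₂ s) (z.P₁ s) (z.P₂ s)) (z.Q₁ s)) I s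
  hP₂ : ∀ s ∈ I, HasDerivWithinAt z.P₂
    (-deriv (fun q => regHam m (-1) (z.Q₁ s) q (z.P₁ s) (z.P₂ s)) (z.Q₂ s)) I s

/-- The initial condition at a binary collision of the inner pair, the outer bodies being at rest
at distance `R ^ 2` from the origin. -/
def StartsAtBC (z : PhaseCurve) (m R : ℝ) : Prop :=
  z.Q₁ 0 = R ∧ z.Q₂ 0 = 0 ∧ z.P₁ 0 = 0 ∧ z.P₂ 0 = 2 * m ^ (3 / 2 : ℝ)

/-- Position of the outer body on the right: `x₁ = q₁ + q₂ / 2` with `qᵢ = Qᵢ ^ 2`. -/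
def x₁ (z : PhaseCurve) (s : ℝ) : ℝ := z.Q₁ s ^ 2 + z.Q₂ s ^ 2 / 2

/-- Position of the inner body on the right: `x₂ = q₂ / 2` with `q₂ = Q₂ ^ 2`. -/
def x₂ (z : PhaseCurve) (s : ℝ) : ℝ := z.Q₂ s ^ 2 / 2

/-- Physical time `t` as a function of `s`: `dt/ds = q₁ q₂` and `t = 0` at `s = 0`. -/
def time (z : PhaseCurve) (s : ℝ) : ℝ := ∫ σ in (0 : ℝ)..s, z.Q₁ σ ^ 2 * z.Q₂ σ ^ 2

end PhaseCurve

/-- Binary collision of the inner bodies (at `±x₂`), away from the outer bodies (at `±x₁`). -/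
def IsBC (x₁ x₂ : ℝ) : Prop := x₂ = 0 ∧ 0 < x₁

/-- Simultaneous binary collision of the two outer/inner pairs, away from the origin. -/
def IsSBC (x₁ x₂ : ℝ) : Prop := x₁ = x₂ ∧ 0 < x₂

/-- `T` is the least positive period of `f`. -/
def HasLeastPeriod {α : Type*} (f : ℝ → α) (T : ℝ) : Prop :=
  0 < T ∧ Function.Periodic f T ∧ ∀ T', 0 < T' → T' < T → ¬ Function.Periodic f T'

/-- Bodies of masses `1, m, m, 1` at `X₁ t, X₂ t, -X₂ t, -X₁ t` move on a Schubart-like orbit of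
energy `-1` and least period `T`: the motion is continuous and `T`-periodic, the bodies stay in
order and never collide all at once, the motion obeys Newton's equations and has energy `-1` away
from collisions, and in each period there are exactly one binary collision of the inner pair (at the
times `tB + k T`) and one simultaneous binary collision (at the times `tS + k T`), so that the two
kinds alternate. -/
structure IsSchubartLike (m : ℝ) (X₁ X₂ : ℝ → ℝ) (T tB tS : ℝ) : Prop where
  continuous₁ : Continuous X₁
  continuous₂ : Continuous X₂
  ordered : ∀ t, 0 ≤ X₂ t ∧ X₂ t ≤ X₁ t ∧ 0 < X₁ t
  period : HasLeastPeriod (fun t => (X₁ t, X₂ t)) T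
  differentiable : ∀ t, 0 < X₂ t → X₂ t < X₁ t → DifferentiableAt ℝ X₁ t ∧ DifferentiableAt ℝ X₂ t
  newton₁ : ∀ t, 0 < X₂ t → X₂ t < X₁ t → HasDerivAt (deriv X₁)
    (-1 / (4 * X₁ t ^ 2) - m / (X₁ t + X₂ t) ^ 2 - m / (X₁ t - X₂ t) ^ 2) t
  newton₂ : ∀ t, 0 < X₂ t → X₂ t < X₁ t → HasDerivAt (deriv X₂)
    (-m / (4 * X₂ t ^ 2) - 1 / (X₁ t + X₂ t) ^ 2 + 1 / (X₁ t - X₂ t) ^ 2) t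
  energy : ∀ t, 0 < X₂ t → X₂ t < X₁ t →
    deriv X₁ t ^ 2 + m * deriv X₂ t ^ 2 - 1 / (2 * X₁ t) - m ^ 2 / (2 * X₂ t)
      - 2 * m / (X₁ t + X₂ t) - 2 * m / (X₁ t - X₂ t) = -1
  bc_iff : ∀ t, IsBC (X₁ t) (X₂ t) ↔ ∃ k : ℤ, t = tB + k * T
  sbc_iff : ∀ t, IsSBC (X₁ t) (X₂ t) ↔ ∃ k : ℤ, t = tS + k * T
  alternate : tB < tS ∧ tS < tB + T

end CollinearFourBody

end

/-! `Γ` has two discrete symmetries. It is even, so the negative of a solution is a solution. It is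
also invariant under the antisymplectic map `reversal`, so `reversal` combined with s ↦ -s sends
solutions to solutions. The initial point has Q₂ = P₁ = 0 and is fixed by `reversal`, so the arc on
[0, s₁] reflects to a solution on [-s₁, s₁] (`exists_reversible_extension`). At s₁, where Q₁ = P₂ =
0, `reversal` acts as negation, so the ends of the reflected arc are opposite, and copies of it with
alternating signs fit together into a global solution with antiperiod 2s₁
(`exists_antiperiodic_extension`). The zeros of Q₁ and Q₂, which are the collisions, are known on
[-s₁, s₁), hence everywhere.

In physical time, positions depend only on the squares of Q₁ and Q₂, so the antiperiod becomes a
period. The rate dt/ds = Q₁²Q₂² is nonnegative with isolated zeros, so s ↦ t(s) is a homeomorphism.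
As `Γ` = (dt/ds)(H - E), its flow is the reparametrized Newtonian flow only on the level `Γ` = 0;
the initial P₂ lies on that level and conservation of `Γ` keeps the solution there. -/

noncomputable section

namespace CollinearFourBody

/-! ### The explicit Hamiltonian field and its two symmetries -/

/-- The Hamiltonian vector field of `regHam m (-1)`. -/
def regField (m : ℝ) (p : ℝ × ℝ × ℝ × ℝ) : ℝ × ℝ × ℝ × ℝ :=
  (p.2.1 ^ 2 * p.2.2.1 / 8 + p.2.1 * (p.2.1 * p.2.2.1 - 2 * p.1 * p.2.2.2) / (8 * m),
   -(p.1 * (p.2.1 * p.2.2.1 - 2 * p.1 * p.2.2.2) / (4 * m)),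
   (p.2.1 * p.2.2.1 - 2 * p.1 * p.2.2.2) * p.2.2.2 / (4 * m) + 2 * m ^ 2 * p.1
     + 4 * m * p.1 * p.2.1 ^ 4 / (p.1 ^ 2 + p.2.1 ^ 2) ^ 2
     + 2 * p.1 * p.2.1 ^ 4 / (2 * p.1 ^ 2 + p.2.1 ^ 2) ^ 2 - 2 * p.1 * p.2.1 ^ 2,
   -(p.2.1 * p.2.2.1 ^ 2 / 8) - (p.2.1 * p.2.2.1 - 2 * p.1 * p.2.2.2) * p.2.2.1 / (8 * m)
     + 4 * m * p.2.1 + 4 * m * p.2.1 * p.1 ^ 4 / (p.1 ^ 2 + p.2.1 ^ 2) ^ 2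
     + 4 * p.2.1 * p.1 ^ 4 / (2 * p.1 ^ 2 + p.2.1 ^ 2) ^ 2 - 2 * p.1 ^ 2 * p.2.1)

/-- The phase space away from total collision. -/
def regDomain : Set (ℝ × ℝ × ℝ × ℝ) := {p | p.1 ≠ 0 ∨ p.2.1 ≠ 0}

/-- Reversing symmetry of the field, fixing the binary collisions with `P₁ = 0`. -/
def reversal (p : ℝ × ℝ × ℝ × ℝ) : ℝ × ℝ × ℝ × ℝ := (p.1, -p.2.1, -p.2.2.1, p.2.2.2)

theorem sq_add_sq_ne_zero {a b : ℝ} (h : a ≠ 0 ∨ b ≠ 0) : a ^ 2 + b ^ 2 ≠ 0 := by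
  rcases h with h | h <;> positivity

theorem two_mul_sq_add_sq_ne_zero {a b : ℝ} (h : a ≠ 0 ∨ b ≠ 0) : 2 * a ^ 2 + b ^ 2 ≠ 0 := by
  rcases h with h | h <;> positivity

/-- `Γ` is even and negation is symplectic. -/
theorem regField_neg (m : ℝ) (p : ℝ × ℝ × ℝ × ℝ) : regField m (-p) = -regField m p := by
  ext <;> simp only [regField, Prod.fst_neg, Prod.snd_neg, neg_sq,
    Even.neg_pow (by decide : Even 4)] <;> ring

/-- `Γ` is invariant under `reversal`, which changes the sign of the symplectic form. -/
theorem regField_reversal (m : ℝ) (p : ℝ × ℝ × ℝ × ℝ) :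
    regField m (reversal p) = -reversal (regField m p) := by
  ext <;> simp only [regField, reversal, Prod.fst_neg, Prod.snd_neg, neg_sq,
    Even.neg_pow (by decide : Even 4)] <;> ring

theorem deriv_regHam_P₁ {m : ℝ} (hm : m ≠ 0) (a b c d : ℝ) :
    deriv (fun p => regHam m (-1) a b p d) c = (regField m (a, b, c, d)).1 := by
  refine HasDerivAt.deriv ?_
  have h := hasDerivAt_id c
  have := ((((((h.pow 2).const_mul (1 / 16 * b ^ 2)).add
    (((((h.pow 2).const_mul (b ^ 2)).sub ((h.const_mul (4 * a * b)).mul_const d)).add_const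
      (4 * a ^ 2 * d ^ 2)).div_const (16 * m))).sub_const
      (m ^ 2 * a ^ 2)).sub_const (2 * m * b ^ 2)).sub_const
      (2 * m * a ^ 2 * b ^ 2 / (a ^ 2 + b ^ 2))).sub_const
      (a ^ 2 * b ^ 2 / (2 * a ^ 2 + b ^ 2) + a ^ 2 * b ^ 2 * (-1))
  convert this using 1
  · ext x; simp [regHam]; ring
  · simp [regField]; field_simp; ring

theorem deriv_regHam_P₂ {m : ℝ} (hm : m ≠ 0) (a b c d : ℝ) :
    deriv (fun p => regHam m (-1) a b c p) d = (regField m (a, b, c, d)).2.1 := by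
  refine HasDerivAt.deriv ?_
  have h := hasDerivAt_id d
  have := ((((h.const_mul (-(4 * a * b * c))).add ((h.pow 2).const_mul (4 * a ^ 2))).div_const
      (16 * m))).add_const
      (1 / 16 * b ^ 2 * c ^ 2 + b ^ 2 * c ^ 2 / (16 * m) - m ^ 2 * a ^ 2 - 2 * m * b ^ 2
      - 2 * m * a ^ 2 * b ^ 2 / (a ^ 2 + b ^ 2)
      - (a ^ 2 * b ^ 2 / (2 * a ^ 2 + b ^ 2) + a ^ 2 * b ^ 2 * (-1)))
  convert this using 1
  · ext x; simp [regHam]; ring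
  · simp [regField]; field_simp; ring

theorem deriv_regHam_Q₁ {m : ℝ} (hm : m ≠ 0) {a b : ℝ} (c d : ℝ) (hab : a ≠ 0 ∨ b ≠ 0) :
    -deriv (fun q => regHam m (-1) q b c d) a = (regField m (a, b, c, d)).2.2.1 := by
  have h := hasDerivAt_id a
  have h2 := h.pow 2
  have := ((((((((h.const_mul (-(4 * b * c * d))).add (h2.const_mul (4 * d ^ 2))).div_const
      (16 * m)).add_const (1 / 16 * b ^ 2 * c ^ 2 + b ^ 2 * c ^ 2 / (16 * m))).sub
      (h2.const_mul (m ^ 2))).sub_const (2 * m * b ^ 2)).sub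
      (((h2.const_mul (2 * m)).mul_const (b ^ 2)).div (h2.add_const (b ^ 2))
        (by simpa using sq_add_sq_ne_zero hab))).sub
      ((h2.mul_const (b ^ 2)).div ((h2.const_mul 2).add_const (b ^ 2))
        (by simpa using two_mul_sq_add_sq_ne_zero hab))).sub ((h2.mul_const (b ^ 2)).mul_const (-1))
  have e : deriv (fun q => regHam m (-1) q b c d) a = _ :=
    (this.congr_of_eventuallyEq (f₁ := fun q => regHam m (-1) q b c d)
      (Eventually.of_forall fun x => by simp [regHam]; ring)).deriv
  rw [e]
  have h1 := sq_add_sq_ne_zero hab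
  have h3 := two_mul_sq_add_sq_ne_zero hab
  simp [regField]; field_simp; ring

theorem deriv_regHam_Q₂ {m : ℝ} (hm : m ≠ 0) {a b : ℝ} (c d : ℝ) (hab : a ≠ 0 ∨ b ≠ 0) :
    -deriv (fun q => regHam m (-1) a q c d) b = (regField m (a, b, c, d)).2.2.2 := by
  have h := hasDerivAt_id b
  have h2 := h.pow 2
  have := ((((((((h2.const_mul (c ^ 2)).add (h.const_mul (-(4 * a * c * d)))).div_const
      (16 * m)).add (h2.const_mul (1 / 16 * c ^ 2))).add_const
      (4 * a ^ 2 * d ^ 2 / (16 * m) - m ^ 2 * a ^ 2)).sub (h2.const_mul (2 * m))).sub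
      ((h2.const_mul (2 * m * a ^ 2)).div (h2.const_add (a ^ 2))
        (by simpa using sq_add_sq_ne_zero hab))).sub
      ((h2.const_mul (a ^ 2)).div (h2.const_add (2 * a ^ 2))
        (by simpa using two_mul_sq_add_sq_ne_zero hab))).sub
      ((h2.const_mul (a ^ 2)).mul_const (-1))
  have e : deriv (fun q => regHam m (-1) a q c d) b = _ :=
    (this.congr_of_eventuallyEq (f₁ := fun q => regHam m (-1) a q c d)
      (Eventually.of_forall fun x => by simp [regHam]; ring)).deriv
  rw [e]
  have h1 := sq_add_sq_ne_zero hab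
  have h3 := two_mul_sq_add_sq_ne_zero hab
  simp [regField]; field_simp; ring

/-- Passage from four scalar equations to one autonomous vector equation, to which the symmetries
and the uniqueness theorem apply. -/
theorem PhaseCurve.isSolutionOn_iff {m : ℝ} (hm : m ≠ 0) (z : PhaseCurve) (I : Set ℝ) :
    z.IsSolutionOn m I ↔ ∀ s ∈ I, z.state s ∈ regDomain ∧
      HasDerivWithinAt z.state (regField m (z.state s)) I s := by
  constructor
  · intro h s hs
    have hd := h.mem_domain s hs
    have h1 := h.hQ₁ s hs
    have h2 := h.hQ₂ s hs
    have h3 := h.hP₁ s hs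
    have h4 := h.hP₂ s hs
    rw [deriv_regHam_P₁ hm] at h1
    rw [deriv_regHam_P₂ hm] at h2
    rw [deriv_regHam_Q₁ hm _ _ hd] at h3
    rw [deriv_regHam_Q₂ hm _ _ hd] at h4
    exact ⟨hd, h1.prodMk (h2.prodMk (h3.prodMk h4))⟩
  · intro h
    have hd : ∀ s ∈ I, z.Q₁ s ≠ 0 ∨ z.Q₂ s ≠ 0 := fun s hs => (h s hs).1
    refine ⟨hd, fun s hs => ?_, fun s hs => ?_, fun s hs => ?_, fun s hs => ?_⟩
    · rw [deriv_regHam_P₁ hm]; exact (h s hs).2.fst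
    · rw [deriv_regHam_P₂ hm]; exact (h s hs).2.snd.fst
    · rw [deriv_regHam_Q₁ hm _ _ (hd s hs)]; exact (h s hs).2.snd.snd.fst
    · rw [deriv_regHam_Q₂ hm _ _ (hd s hs)]; exact (h s hs).2.snd.snd.snd

theorem contDiffAt_regField (m : ℝ) {p : ℝ × ℝ × ℝ × ℝ} (hp : p ∈ regDomain) :
    ContDiffAt ℝ 1 (regField m) p := by
  have h1 := pow_ne_zero 2 (sq_add_sq_ne_zero hp)
  have h2 := pow_ne_zero 2 (two_mul_sq_add_sq_ne_zero hp)
  unfold regField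
  -- Constant denominators become constant factors, so the only nonvanishing conditions left are
  -- `h1` and `h2`.
  simp only [div_eq_mul_inv _ (8 * m), div_eq_mul_inv _ (4 * m)]
  fun_prop (disch := assumption)

theorem locallyLipschitzOn_regField (m : ℝ) : LocallyLipschitzOn regDomain (regField m) := by
  intro p hp
  obtain ⟨K, t, ht, h⟩ := (contDiffAt_regField m hp).exists_lipschitzOnWith
  exact ⟨K, t, mem_nhdsWithin_of_mem_nhds ht, h⟩

/-! ### Uniqueness of solutions on intervals -/

/-- Two solutions, on `[0, b]`, of an autonomous equation with locally Lipschitz right side agree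
if they start at the same point. -/
theorem eqOn_Icc_of_locallyLipschitzOn {E : Type*} [NormedAddCommGroup E] [NormedSpace ℝ E]
    {f : E → E} {U : Set E} (hf : LocallyLipschitzOn U f) {u v : ℝ → E} {b : ℝ}
    (hu : ∀ s ∈ Icc 0 b, u s ∈ U ∧ HasDerivWithinAt u (f (u s)) (Icc 0 b) s)
    (hv : ∀ s ∈ Icc 0 b, v s ∈ U ∧ HasDerivWithinAt v (f (v s)) (Icc 0 b) s)
    (h0 : u 0 = v 0) : EqOn u v (Icc 0 b) := by
  have hcu : ContinuousOn u (Icc 0 b) := fun s hs => (hu s hs).2.continuousWithinAt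
  have hcv : ContinuousOn v (Icc 0 b) := fun s hs => (hv s hs).2.continuousWithinAt
  -- Both trajectories lie in one compact subset of `U`, where a single Lipschitz constant serves.
  have hK := (isCompact_Icc.image_of_continuousOn hcu).union
    (isCompact_Icc.image_of_continuousOn hcv)
  have hsub : u '' Icc 0 b ∪ v '' Icc 0 b ⊆ U :=
    union_subset (image_subset_iff.2 fun s hs => (hu s hs).1)
      (image_subset_iff.2 fun s hs => (hv s hs).1)
  obtain ⟨K, hL⟩ := (hf.mono hsub).exists_lipschitzOnWith_of_compact hK
  have hright : ∀ s ∈ Ico 0 b, Icc 0 b ∈ 𝓝[≥] s := fun s hs =>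
    mem_of_superset (Icc_mem_nhdsGE hs.2) (Icc_subset_Icc_left hs.1)
  exact ODE_solution_unique_of_mem_Icc_right (v := fun _ => f)
    (s := fun _ => u '' Icc 0 b ∪ v '' Icc 0 b) (K := K) (fun _ _ => hL) hcu
    (fun s hs => (hu s (Ico_subset_Icc_self hs)).2.mono_of_mem_nhdsWithin (hright s hs))
    (fun s hs => Or.inl ⟨s, Ico_subset_Icc_self hs, rfl⟩) hcv
    (fun s hs => (hv s (Ico_subset_Icc_self hs)).2.mono_of_mem_nhdsWithin (hright s hs))
    (fun s hs => Or.inr ⟨s, Ico_subset_Icc_self hs, rfl⟩) h0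

theorem hasDerivWithinAt_comp_neg {E : Type*} [NormedAddCommGroup E] [NormedSpace ℝ E]
    {u : ℝ → E} {u' : E} {I J : Set ℝ} {s : ℝ} (h : HasDerivWithinAt u u' I (-s))
    (hIJ : ∀ x ∈ J, -x ∈ I) : HasDerivWithinAt (fun x => u (-x)) (-u') J s := by
  simpa [Function.comp_def] using HasDerivWithinAt.scomp s h (hasDerivWithinAt_neg s J) hIJ

/-- Order-connectedness puts the segment from 0 to each point inside `I`; for negative times,
reversing time replaces `f` by `-f`. -/
theorem eqOn_of_locallyLipschitzOn {E : Type*} [NormedAddCommGroup E] [NormedSpace ℝ E]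
    {f : E → E} {U : Set E} (hf : LocallyLipschitzOn U f) {u v : ℝ → E} {I : Set ℝ}
    (hI : I.OrdConnected) (hI0 : 0 ∈ I)
    (hu : ∀ s ∈ I, u s ∈ U ∧ HasDerivWithinAt u (f (u s)) I s)
    (hv : ∀ s ∈ I, v s ∈ U ∧ HasDerivWithinAt v (f (v s)) I s)
    (h0 : u 0 = v 0) : EqOn u v I := by
  intro s hs
  rcases le_total 0 s with h | h
  · have hsub := hI.out hI0 hs
    exact eqOn_Icc_of_locallyLipschitzOn hf
      (fun x hx => ⟨(hu x (hsub hx)).1, (hu x (hsub hx)).2.mono hsub⟩)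
      (fun x hx => ⟨(hv x (hsub hx)).1, (hv x (hsub hx)).2.mono hsub⟩) h0 ⟨h, le_rfl⟩
  · have hsub : ∀ x ∈ Icc 0 (-s), -x ∈ I := fun x hx =>
      hI.out hs hI0 ⟨by linarith [hx.2], by linarith [hx.1]⟩
    have hg : LocallyLipschitzOn U (fun x => -f x) := by
      intro x hx
      obtain ⟨K, t, ht, hl⟩ := hf hx
      exact ⟨K, t, ht, hl.neg⟩
    have := eqOn_Icc_of_locallyLipschitzOn (u := fun x => u (-x)) (v := fun x => v (-x)) hg
      (fun x hx => ⟨(hu _ (hsub x hx)).1, hasDerivWithinAt_comp_neg (hu _ (hsub x hx)).2 hsub⟩)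
      (fun x hx => ⟨(hv _ (hsub x hx)).1, hasDerivWithinAt_comp_neg (hv _ (hsub x hx)).2 hsub⟩)
      (by simpa using h0) (x := -s) ⟨by linarith, le_rfl⟩
    simpa using this

/-! ### Extension by antiperiodicity -/

theorem exists_eq_add_two_mul {a : ℝ} (ha : 0 < a) (s : ℝ) :
    ∃ (k : ℤ) (u : ℝ), u ∈ Ico (-a) a ∧ s = u + 2 * k * a := by
  refine ⟨⌊(s + a) / (2 * a)⌋, s - 2 * ⌊(s + a) / (2 * a)⌋ * a, ⟨?_, ?_⟩, by ring⟩
  · have := Int.floor_le ((s + a) / (2 * a))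
    rw [le_div_iff₀ (by positivity)] at this
    linarith
  · have := Int.lt_floor_add_one ((s + a) / (2 * a))
    rw [div_lt_iff₀ (by positivity)] at this
    linarith

theorem floor_add_two_mul {a : ℝ} (ha : 0 < a) (k : ℤ) {u : ℝ} (hu : u ∈ Ico (-a) a) :
    ⌊(u + 2 * k * a + a) / (2 * a)⌋ = k := by
  rw [Int.floor_eq_iff, le_div_iff₀ (by positivity), div_lt_iff₀ (by positivity)]
  constructor <;> nlinarith [hu.1, hu.2]

/-- A solution on `[-a, a]` of an autonomous equation with odd right side, taking opposite values at
the two end points, extends to a solution for all times, antiperiodic with antiperiod `2 a`. -/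
theorem exists_antiperiodic_extension {E : Type*} [NormedAddCommGroup E] [NormedSpace ℝ E]
    {f : E → E} (hf : ∀ p, f (-p) = -f p) {U : Set E} (hU : ∀ p ∈ U, -p ∈ U) {a : ℝ} (ha : 0 < a)
    {g : ℝ → E}
    (hg : ∀ s ∈ Icc (-a) a, g s ∈ U ∧ HasDerivWithinAt g (f (g s)) (Icc (-a) a) s)
    (h : g a = -g (-a)) :
    ∃ G : ℝ → E, (∀ s, G s ∈ U ∧ HasDerivAt G (f (G s)) s) ∧
      (∀ (k : ℤ), ∀ u ∈ Icc (-a) a, G (u + 2 * k * a) = (-1 : ℝ) ^ k • g u) := by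
  set G : ℝ → E := fun s =>
    (-1 : ℝ) ^ ⌊(s + a) / (2 * a)⌋ • g (s - 2 * ⌊(s + a) / (2 * a)⌋ * a) with hGdef
  have hG : ∀ (k : ℤ), ∀ u ∈ Icc (-a) a, G (u + 2 * k * a) = (-1 : ℝ) ^ k • g u := by
    intro k u hu
    rcases hu.2.lt_or_eq with h' | rfl
    · simp only [hGdef, floor_add_two_mul ha k ⟨hu.1, h'⟩]
      congr 2
      ring
    -- The floor assigns the right end point to the next cell, as its left end point; `h` reconciles
    -- the two signs.
    · have e : u + 2 * k * u = -u + 2 * ((k + 1 : ℤ) : ℝ) * u := by push_cast; ring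
      rw [e]
      simp only [hGdef, floor_add_two_mul ha (k + 1) (u := -u) ⟨le_rfl, by linarith⟩]
      rw [add_sub_cancel_right, zpow_add₀ (by norm_num), h]
      simp
  have hsmul : ∀ (k : ℤ) (p : E), f ((-1 : ℝ) ^ k • p) = (-1 : ℝ) ^ k • f p := by
    intro k p
    rcases Int.even_or_odd k with hk | hk
    · simp [hk.neg_one_zpow]
    · simp [hk.neg_one_zpow, hf]
  have hUmul : ∀ (k : ℤ), ∀ p ∈ U, (-1 : ℝ) ^ k • p ∈ U := by
    intro k p hp
    rcases Int.even_or_odd k with hk | hk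
    · simpa [hk.neg_one_zpow] using hp
    · simpa [hk.neg_one_zpow] using hU p hp
  have hd : ∀ (k : ℤ), ∀ u ∈ Icc (-a) a, HasDerivWithinAt G (f (G (u + 2 * k * a)))
      (Icc (2 * k * a - a) (2 * k * a + a)) (u + 2 * k * a) := by
    intro k u hu
    have hmap : MapsTo (fun s => s - 2 * k * a) (Icc (2 * k * a - a) (2 * k * a + a))
        (Icc (-a) a) := fun s hs => ⟨by linarith [hs.1], by linarith [hs.2]⟩
    have h1 : HasDerivWithinAt g (f (g u)) (Icc (-a) a) (u + 2 * k * a - 2 * k * a) := by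
      simpa using (hg u hu).2
    have h2 := (HasDerivWithinAt.scomp (u + 2 * k * a) h1
      ((hasDerivWithinAt_id _ _).sub_const (2 * k * a)) hmap).const_smul ((-1 : ℝ) ^ k)
    rw [hG k u hu, hsmul]
    refine (one_smul ℝ (f (g u)) ▸ h2).congr_of_mem (fun s hs => ?_)
      ⟨by linarith [hu.1], by linarith [hu.2]⟩
    have := hG k (s - 2 * k * a) (hmap hs)
    rw [sub_add_cancel] at this
    simpa using this
  refine ⟨G, fun s => ?_, hG⟩
  obtain ⟨k, u, hu, rfl⟩ := exists_eq_add_two_mul ha s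
  refine ⟨hG k u (Ico_subset_Icc_self hu) ▸ hUmul k _ (hg u (Ico_subset_Icc_self hu)).1, ?_⟩
  have h1 := hd k u (Ico_subset_Icc_self hu)
  rcases hu.1.lt_or_eq with h' | rfl
  · exact h1.hasDerivAt (Icc_mem_nhds (by linarith) (by linarith [hu.2]))
  -- At a seam, the one-sided derivatives from cells `k - 1` and `k` are both the field at the
  -- common point.
  · have h2 := hd (k - 1) a ⟨by linarith, le_rfl⟩
    have e : a + 2 * ((k - 1 : ℤ) : ℝ) * a = -a + 2 * k * a := by push_cast; ring
    rw [e] at h2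
    refine (h2.union h1).hasDerivAt ?_
    refine mem_of_superset (Ioo_mem_nhds (a := 2 * k * a - 2 * a) (b := 2 * k * a)
      (by linarith) (by linarith)) fun s hs => ?_
    rcases le_total s (2 * k * a - a) with h3 | h3
    · left; push_cast; exact ⟨by linarith [hs.1], by linarith⟩
    · right; exact ⟨h3, by linarith [hs.2]⟩

/-! ### Extension by time reversal -/

theorem reversal_reversal (p : ℝ × ℝ × ℝ × ℝ) : reversal (reversal p) = p := by
  simp [reversal]

theorem reversal_mem_regDomain {p : ℝ × ℝ × ℝ × ℝ} (hp : p ∈ regDomain) :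
    reversal p ∈ regDomain := by
  simpa [reversal, regDomain] using hp

theorem neg_mem_regDomain {p : ℝ × ℝ × ℝ × ℝ} (hp : p ∈ regDomain) : -p ∈ regDomain := by
  simpa [regDomain] using hp

theorem hasDerivWithinAt_reversal {u : ℝ → ℝ × ℝ × ℝ × ℝ} {u' : ℝ × ℝ × ℝ × ℝ} {I : Set ℝ} {s : ℝ}
    (h : HasDerivWithinAt u u' I s) :
    HasDerivWithinAt (fun x => reversal (u x)) (reversal u') I s := by
  have h1 : HasDerivWithinAt (fun x => (u x).1) u'.1 I s := h.fst
  have h2 : HasDerivWithinAt (fun x => (u x).2.1) u'.2.1 I s := h.snd.fst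
  have h3 : HasDerivWithinAt (fun x => (u x).2.2.1) u'.2.2.1 I s := h.snd.snd.fst
  have h4 : HasDerivWithinAt (fun x => (u x).2.2.2) u'.2.2.2 I s := h.snd.snd.snd
  exact h1.prodMk (h2.fun_neg.prodMk (h3.fun_neg.prodMk h4))

/-- The time-reversed mirror image of a solution is a solution. -/
theorem hasDerivWithinAt_reversal_comp_neg {m : ℝ} {u : ℝ → ℝ × ℝ × ℝ × ℝ} {I J : Set ℝ} {s : ℝ}
    (h : HasDerivWithinAt u (regField m (u (-s))) I (-s)) (hIJ : ∀ x ∈ J, -x ∈ I) :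
    HasDerivWithinAt (fun x => reversal (u (-x))) (regField m (reversal (u (-s)))) J s := by
  have := hasDerivWithinAt_reversal (hasDerivWithinAt_comp_neg h hIJ)
  convert this using 1
  rw [regField_reversal]
  simp [reversal]

/-- A solution on `[0, a]` starting at a fixed point of the reversal extends to `[-a, a]`. -/
theorem exists_reversible_extension {m a : ℝ} (ha : 0 < a) {u : ℝ → ℝ × ℝ × ℝ × ℝ}
    (hu : ∀ s ∈ Icc 0 a, u s ∈ regDomain ∧ HasDerivWithinAt u (regField m (u s)) (Icc 0 a) s)
    (h0 : reversal (u 0) = u 0) :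
    ∃ g : ℝ → ℝ × ℝ × ℝ × ℝ,
      (∀ s ∈ Icc (-a) a, g s ∈ regDomain ∧
        HasDerivWithinAt g (regField m (g s)) (Icc (-a) a) s) ∧
      (∀ s, 0 ≤ s → g s = u s) ∧ ∀ s ≤ 0, g s = reversal (u (-s)) := by
  set g : ℝ → ℝ × ℝ × ℝ × ℝ := fun s => if 0 ≤ s then u s else reversal (u (-s)) with hgdef
  have hpos : ∀ s, 0 ≤ s → g s = u s := fun s hs => by simp [hgdef, hs]
  have hneg : ∀ s ≤ 0, g s = reversal (u (-s)) := by
    intro s hs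
    rcases hs.lt_or_eq with h | rfl
    · simp [hgdef, h]
    · simp [hgdef, h0]
  refine ⟨g, fun s hs => ?_, hpos, hneg⟩
  have hun : Icc (-a) a = Icc (-a) 0 ∪ Icc 0 a :=
    (Icc_union_Icc_eq_Icc (by linarith) ha.le).symm
  have hp : 0 ≤ s → HasDerivWithinAt g (regField m (g s)) (Icc 0 a) s := by
    intro h
    rw [hpos s h]
    exact (hu s ⟨h, hs.2⟩).2.congr_of_mem (fun x hx => hpos x hx.1) ⟨h, hs.2⟩
  have hn : s ≤ 0 → HasDerivWithinAt g (regField m (g s)) (Icc (-a) 0) s := by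
    intro h
    rw [hneg s h]
    exact (hasDerivWithinAt_reversal_comp_neg (hu (-s) ⟨by linarith, by linarith [hs.1]⟩).2
      fun x hx => ⟨by linarith [hx.2], by linarith [hx.1]⟩).congr_of_mem
      (fun x hx => hneg x hx.2) ⟨hs.1, h⟩
  constructor
  · rcases le_total 0 s with h | h
    · rw [hpos s h]; exact (hu s ⟨h, hs.2⟩).1
    · rw [hneg s h]
      exact reversal_mem_regDomain (hu (-s) ⟨by linarith, by linarith [hs.1]⟩).1
  · rw [hun]
    rcases lt_trichotomy s 0 with h | h | h
    · rw [← hun]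
      refine (hn h.le).mono_of_mem_nhdsWithin (mem_nhdsWithin.2 ⟨Iio 0, isOpen_Iio, h, ?_⟩)
      exact fun x hx => ⟨hx.2.1, le_of_lt hx.1⟩
    -- At the junction both one-sided derivatives equal the field at `g 0`.
    · exact (hn h.le).union (hp h.ge)
    · rw [← hun]
      refine (hp h.le).mono_of_mem_nhdsWithin (mem_nhdsWithin.2 ⟨Ioi 0, isOpen_Ioi, h, ?_⟩)
      exact fun x hx => ⟨le_of_lt hx.1, hx.2.2⟩

/-- A symmetric regularized periodic orbit: a global solution, reversible at `s = 0`, antiperiodic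
with antiperiod `2 a`, of zero energy level, with the collisions of each kind at the even and odd
multiples of `a`. -/
structure IsSymmetricOrbit (z : PhaseCurve) (m a : ℝ) : Prop where
  sol : z.IsSolutionOn m univ
  reversible : ∀ s, z.state (-s) = reversal (z.state s)
  antiperiodic : ∀ s, z.state (s + 2 * a) = -z.state s
  Q₁_eq_zero_iff : ∀ s, z.Q₁ s = 0 ↔ ∃ k : ℤ, s = (2 * k + 1) * a
  Q₂_eq_zero_iff : ∀ s, z.Q₂ s = 0 ↔ ∃ k : ℤ, s = 2 * k * a
  level : ∀ s, regHam m (-1) (z.Q₁ s) (z.Q₂ s) (z.P₁ s) (z.P₂ s) = 0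

/-! ### Conservation of `Γ` and return to Newton's equations -/

namespace PhaseCurve

variable {z : PhaseCurve} {m : ℝ}

theorem IsSolutionOn.hasDerivAt (hz : z.IsSolutionOn m univ) (hm : m ≠ 0) (s : ℝ) :
    HasDerivAt z.Q₁ (regField m (z.state s)).1 s ∧ HasDerivAt z.Q₂ (regField m (z.state s)).2.1 s ∧
    HasDerivAt z.P₁ (regField m (z.state s)).2.2.1 s ∧
    HasDerivAt z.P₂ (regField m (z.state s)).2.2.2 s := by
  have h := (((isSolutionOn_iff hm z univ).1 hz) s (mem_univ s)).2
  refine ⟨?_, ?_, ?_, ?_⟩ <;> rw [← hasDerivWithinAt_univ]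
  exacts [h.fst, h.snd.fst, h.snd.snd.fst, h.snd.snd.snd]

theorem IsSolutionOn.hasDerivAt_regHam (hz : z.IsSolutionOn m univ) (hm : m ≠ 0) (s : ℝ) :
    HasDerivAt (fun s => regHam m (-1) (z.Q₁ s) (z.Q₂ s) (z.P₁ s) (z.P₂ s)) 0 s := by
  obtain ⟨h1, h2, h3, h4⟩ := hz.hasDerivAt hm s
  have hd := hz.mem_domain s (mem_univ s)
  have hD1 := sq_add_sq_ne_zero hd
  have hD2 := two_mul_sq_add_sq_ne_zero hd
  have q1 := h1.fun_pow 2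
  have q2 := h2.fun_pow 2
  have q := q1.fun_mul q2
  -- The part of the kinetic term divided by 16m is the square of Q₂P₁ - 2Q₁P₂.
  have A := (h2.fun_mul h3).fun_sub ((h1.fun_mul h4).const_mul 2)
  have := (((((((q2.fun_mul (h3.fun_pow 2)).const_mul (1 / 16)).fun_add
    ((A.fun_pow 2).div_const (16 * m))).fun_sub (q1.const_mul (m ^ 2))).fun_sub
      (q2.const_mul (2 * m))).fun_sub
      ((q.const_mul (2 * m)).fun_div (q1.fun_add q2) hD1)).fun_sub
      (q.fun_div ((q1.const_mul 2).fun_add q2) hD2)).fun_sub (q.mul_const (-1))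
  refine (this.congr_deriv ?_).congr_of_eventuallyEq
    (Eventually.of_forall fun x => by simp only [regHam]; ring)
  · simp only [regField, state]
    generalize z.Q₁ s = a at *
    generalize z.Q₂ s = b at *
    generalize z.P₁ s = c at *
    generalize z.P₂ s = d at *
    field_simp
    ring

theorem IsSolutionOn.regHam_eq (hz : z.IsSolutionOn m univ) (hm : m ≠ 0) (s s' : ℝ) :
    regHam m (-1) (z.Q₁ s) (z.Q₂ s) (z.P₁ s) (z.P₂ s) =
      regHam m (-1) (z.Q₁ s') (z.Q₂ s') (z.P₁ s') (z.P₂ s') :=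
  is_const_of_deriv_eq_zero (fun x => (hz.hasDerivAt_regHam hm x).differentiableAt)
    (fun x => (hz.hasDerivAt_regHam hm x).deriv) s s'

theorem IsSolutionOn.hasDerivAt_x₁ (hz : z.IsSolutionOn m univ) (hm : m ≠ 0) (s : ℝ) :
    HasDerivAt z.x₁ (z.Q₁ s * z.Q₂ s ^ 2 * z.P₁ s / 4) s := by
  obtain ⟨h1, h2, -, -⟩ := hz.hasDerivAt hm s
  refine ((h1.fun_pow 2).fun_add ((h2.fun_pow 2).div_const 2)).congr_deriv ?_
  simp only [regField, state]
  field_simp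
  ring

theorem IsSolutionOn.hasDerivAt_x₂ (hz : z.IsSolutionOn m univ) (hm : m ≠ 0) (s : ℝ) :
    HasDerivAt z.x₂ (-(z.Q₁ s * z.Q₂ s * (z.Q₂ s * z.P₁ s - 2 * z.Q₁ s * z.P₂ s) / (4 * m))) s := by
  obtain ⟨-, h2, -, -⟩ := hz.hasDerivAt hm s
  refine ((h2.fun_pow 2).div_const 2).congr_deriv ?_
  simp only [regField, state]
  field_simp
  ring

/-- The velocity `dx₁/dt` as a function of the regularized time. -/
def v₁ (z : PhaseCurve) (s : ℝ) : ℝ := z.P₁ s / (4 * z.Q₁ s)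

/-- The velocity `dx₂/dt` as a function of the regularized time. -/
def v₂ (z : PhaseCurve) (m : ℝ) (s : ℝ) : ℝ :=
  z.P₂ s / (2 * m * z.Q₂ s) - z.P₁ s / (4 * m * z.Q₁ s)

/-- Differentiating `Γ` = Q₁²Q₂²(H - E) also differentiates the factor Q₁²Q₂²; this leaves a
multiple of `Γ`, which vanishes on the zero level. -/
theorem IsSolutionOn.hasDerivAt_v₁ (hz : z.IsSolutionOn m univ) (hm : m ≠ 0) {s : ℝ}
    (hΓ : regHam m (-1) (z.Q₁ s) (z.Q₂ s) (z.P₁ s) (z.P₂ s) = 0)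
    (hQ₁ : z.Q₁ s ≠ 0) :
    HasDerivAt z.v₁ ((-1 / (4 * z.x₁ s ^ 2) - m / (z.x₁ s + z.x₂ s) ^ 2
      - m / (z.x₁ s - z.x₂ s) ^ 2) * (z.Q₁ s ^ 2 * z.Q₂ s ^ 2)) s := by
  obtain ⟨h1, -, h3, -⟩ := hz.hasDerivAt hm s
  have hD1 := sq_add_sq_ne_zero (Or.inl hQ₁ : z.Q₁ s ≠ 0 ∨ z.Q₂ s ≠ 0)
  have hD2 := two_mul_sq_add_sq_ne_zero (Or.inl hQ₁ : z.Q₁ s ≠ 0 ∨ z.Q₂ s ≠ 0)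
  refine (h3.fun_div (h1.const_mul 4) (by simpa using hQ₁)).congr_deriv ?_
  simp only [regField, state, x₁, x₂] at *
  unfold regHam at hΓ
  generalize z.Q₁ s = a at *
  generalize z.Q₂ s = b at *
  generalize z.P₁ s = c at *
  generalize z.P₂ s = d at *
  have e1 : a ^ 2 + b ^ 2 / 2 = (2 * a ^ 2 + b ^ 2) / 2 := by ring
  have e2 : (2 * a ^ 2 + b ^ 2) / 2 + b ^ 2 / 2 = a ^ 2 + b ^ 2 := by ring
  have e3 : (2 * a ^ 2 + b ^ 2) / 2 - b ^ 2 / 2 = a ^ 2 := by ring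
  rw [e1, e2, e3]
  linear_combination (norm := skip) (-1 / (2 * a ^ 2)) * hΓ
  field_simp
  ring

theorem IsSolutionOn.hasDerivAt_v₂ (hz : z.IsSolutionOn m univ) (hm : m ≠ 0) {s : ℝ}
    (hΓ : regHam m (-1) (z.Q₁ s) (z.Q₂ s) (z.P₁ s) (z.P₂ s) = 0)
    (hQ₁ : z.Q₁ s ≠ 0) (hQ₂ : z.Q₂ s ≠ 0) :
    HasDerivAt (z.v₂ m) ((-m / (4 * z.x₂ s ^ 2) - 1 / (z.x₁ s + z.x₂ s) ^ 2
      + 1 / (z.x₁ s - z.x₂ s) ^ 2) * (z.Q₁ s ^ 2 * z.Q₂ s ^ 2)) s := by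
  obtain ⟨h1, h2, h3, h4⟩ := hz.hasDerivAt hm s
  have hD1 := sq_add_sq_ne_zero (Or.inl hQ₁ : z.Q₁ s ≠ 0 ∨ z.Q₂ s ≠ 0)
  have hD2 := two_mul_sq_add_sq_ne_zero (Or.inl hQ₁ : z.Q₁ s ≠ 0 ∨ z.Q₂ s ≠ 0)
  refine ((h4.fun_div (h2.const_mul (2 * m)) (by simp [hm, hQ₂])).fun_sub
    (h3.fun_div (h1.const_mul (4 * m)) (by simp [hm, hQ₁]))).congr_deriv ?_
  simp only [regField, state, x₁, x₂] at *
  unfold regHam at hΓ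
  generalize z.Q₁ s = a at *
  generalize z.Q₂ s = b at *
  generalize z.P₁ s = c at *
  generalize z.P₂ s = d at *
  have e1 : a ^ 2 + b ^ 2 / 2 = (2 * a ^ 2 + b ^ 2) / 2 := by ring
  have e2 : (2 * a ^ 2 + b ^ 2) / 2 + b ^ 2 / 2 = a ^ 2 + b ^ 2 := by ring
  have e3 : (2 * a ^ 2 + b ^ 2) / 2 - b ^ 2 / 2 = a ^ 2 := by ring
  rw [e1, e2, e3]
  -- The excess terms are -2Γ/Q₁ in P₁' and -2Γ/Q₂ in P₂'; the coefficient collects their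
  -- contributions to the derivative of `v₂`.
  linear_combination (norm := skip) (1 / (2 * m * a ^ 2) - 1 / (m * b ^ 2)) * hΓ
  field_simp
  ring

theorem energy_eq (hm : m ≠ 0) {s : ℝ}
    (hΓ : regHam m (-1) (z.Q₁ s) (z.Q₂ s) (z.P₁ s) (z.P₂ s) = 0)
    (hQ₁ : z.Q₁ s ≠ 0) (hQ₂ : z.Q₂ s ≠ 0) :
    z.v₁ s ^ 2 + m * z.v₂ m s ^ 2 - 1 / (2 * z.x₁ s) - m ^ 2 / (2 * z.x₂ s)
      - 2 * m / (z.x₁ s + z.x₂ s) - 2 * m / (z.x₁ s - z.x₂ s) = -1 := by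
  have hD1 := sq_add_sq_ne_zero (Or.inl hQ₁ : z.Q₁ s ≠ 0 ∨ z.Q₂ s ≠ 0)
  have hD2 := two_mul_sq_add_sq_ne_zero (Or.inl hQ₁ : z.Q₁ s ≠ 0 ∨ z.Q₂ s ≠ 0)
  simp only [v₁, v₂, x₁, x₂] at *
  unfold regHam at hΓ
  generalize z.Q₁ s = a at *
  generalize z.Q₂ s = b at *
  generalize z.P₁ s = c at *
  generalize z.P₂ s = d at *
  have e1 : a ^ 2 + b ^ 2 / 2 = (2 * a ^ 2 + b ^ 2) / 2 := by ring
  have e2 : (2 * a ^ 2 + b ^ 2) / 2 + b ^ 2 / 2 = a ^ 2 + b ^ 2 := by ring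
  have e3 : (2 * a ^ 2 + b ^ 2) / 2 - b ^ 2 / 2 = a ^ 2 := by ring
  rw [e1, e2, e3]
  linear_combination (norm := skip) (1 / (a ^ 2 * b ^ 2)) * hΓ
  field_simp
  ring

end PhaseCurve

/-! ### Construction of the symmetric orbit -/

/-- With P₂² = 4m³ the kinetic term Q₁²P₂²/(4m) cancels m²Q₁², whatever `R` is. -/
theorem regHam_binaryCollision {m : ℝ} (hm : 0 < m) (R : ℝ) :
    regHam m (-1) R 0 0 (2 * m ^ (3 / 2 : ℝ)) = 0 := by
  have h : (m ^ (3 / 2 : ℝ)) ^ 2 = m ^ 3 := by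
    rw [← Real.rpow_natCast, ← Real.rpow_mul hm.le, ← Real.rpow_natCast]
    norm_num
  simp only [regHam, mul_pow, h]
  field_simp
  ring

theorem exists_isSymmetricOrbit {m R a : ℝ} (hm : 0 < m) (ha : 0 < a) {y : PhaseCurve}
    (hy : y.IsSolutionOn m (Icc 0 a)) (hy0 : y.StartsAtBC m R)
    (hsbc : y.Q₁ a = 0) (hfirst : ∀ s ∈ Ico 0 a, y.Q₁ s ≠ 0)
    (hnobc : ∀ s ∈ Ioc 0 a, 0 < y.Q₂ s) (hP₂ : y.P₂ a = 0) :
    ∃ z : PhaseCurve, z.StartsAtBC m R ∧ IsSymmetricOrbit z m a := by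
  obtain ⟨hQ10, hQ20, hP10, hP20⟩ := hy0
  obtain ⟨g, hg, hpos, hneg⟩ := exists_reversible_extension ha
    ((PhaseCurve.isSolutionOn_iff hm.ne' y _).1 hy)
    (by simp [reversal, PhaseCurve.state, hQ20, hP10])
  -- The state at `a` has the form (0, Q₂, P₁, 0), which `reversal` sends to its negative.
  obtain ⟨G, hG, hGg⟩ := exists_antiperiodic_extension (regField_neg m)
    (fun p hp => neg_mem_regDomain hp) ha hg (by
      rw [hpos a ha.le, hneg (-a) (by linarith)]
      simp [reversal, PhaseCurve.state, hsbc, hP₂])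
  set z : PhaseCurve := ⟨fun s => (G s).1, fun s => (G s).2.1, fun s => (G s).2.2.1,
    fun s => (G s).2.2.2⟩ with hz
  have hzG : z.state = G := rfl
  have hsol : z.IsSolutionOn m univ := (PhaseCurve.isSolutionOn_iff hm.ne' z _).2 fun s _ =>
    ⟨(hG s).1, (hG s).2.hasDerivWithinAt⟩
  have h0 : G 0 = y.state 0 := by
    have := hGg 0 0 ⟨by linarith, ha.le⟩
    rw [hpos 0 le_rfl] at this
    simpa using this
  have hz0 : z.StartsAtBC m R := by
    simp only [PhaseCurve.StartsAtBC, hz, h0]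
    exact ⟨hQ10, hQ20, hP10, hP20⟩
  have hQ₁ : ∀ u ∈ Ico (-a) a, (g u).1 = 0 ↔ u = -a := by
    intro u hu
    refine ⟨fun h => ?_, fun h => ?_⟩
    · by_contra hne
      rcases le_total 0 u with h' | h'
      · exact hfirst u ⟨h', hu.2⟩ (by rwa [hpos u h'] at h)
      · refine hfirst (-u) ⟨by linarith, ?_⟩ (by rwa [hneg u h'] at h)
        have := lt_of_le_of_ne hu.1 (Ne.symm hne)
        linarith
    · rw [h, hneg (-a) (by linarith)]
      simpa [reversal, PhaseCurve.state] using hsbc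
  have hQ₂ : ∀ u ∈ Ico (-a) a, (g u).2.1 = 0 ↔ u = 0 := by
    intro u hu
    refine ⟨fun h => ?_, fun h => ?_⟩
    · rcases lt_trichotomy u 0 with h' | h' | h'
      · have := hnobc (-u) ⟨by linarith, by linarith [hu.1]⟩
        rw [hneg u h'.le] at h
        simp [reversal, PhaseCurve.state] at h
        linarith
      · exact h'
      · have := hnobc u ⟨h', hu.2.le⟩
        rw [hpos u h'.le] at h
        simp [PhaseCurve.state] at h
        linarith
    · rw [h, hpos 0 le_rfl]
      exact hQ20
  refine ⟨z, hz0, hsol, fun s => ?_, fun s => ?_, fun s => ?_, fun s => ?_, fun s => ?_⟩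
  -- The reversed curve solves the same equation from the same initial point, so uniqueness
  -- identifies it with `G`.
  · have hr := eqOn_of_locallyLipschitzOn (locallyLipschitzOn_regField m) ordConnected_univ
      (mem_univ 0) (u := fun s => reversal (G (-s))) (v := G)
      (fun s _ => ⟨reversal_mem_regDomain (hG _).1,
        hasDerivWithinAt_reversal_comp_neg (hG (-s)).2.hasDerivWithinAt (I := univ) (by simp)⟩)
      (fun s _ => ⟨(hG s).1, (hG s).2.hasDerivWithinAt⟩)
      (by simp [h0, reversal, PhaseCurve.state, hQ20, hP10]) (mem_univ s)
    rw [hzG, ← hr]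
    exact (reversal_reversal _).symm
  · obtain ⟨k, u, hu, rfl⟩ := exists_eq_add_two_mul ha s
    have e : u + 2 * k * a + 2 * a = u + 2 * ((k + 1 : ℤ) : ℝ) * a := by push_cast; ring
    rw [hzG, e, hGg _ u (Ico_subset_Icc_self hu), hGg _ u (Ico_subset_Icc_self hu),
      zpow_add₀ (by norm_num)]
    simp
  · obtain ⟨k, u, hu, rfl⟩ := exists_eq_add_two_mul ha s
    change (G _).1 = 0 ↔ _
    rw [hGg _ u (Ico_subset_Icc_self hu), Prod.smul_fst, smul_eq_zero_iff_right (zpow_ne_zero k (by norm_num)), hQ₁ u hu]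
    constructor
    · rintro rfl
      exact ⟨k - 1, by push_cast; ring⟩
    · rintro ⟨j, hj⟩
      -- The only odd multiple of `a` in [-a, a) is -a.
      have hu' : u = (2 * (j - k) + 1 : ℤ) * a := by push_cast; linarith
      have h1 : (-1 : ℤ) ≤ 2 * (j - k) + 1 := by
        have := hu.1
        rw [hu'] at this
        exact_mod_cast (le_of_mul_le_mul_right (by linarith) ha :
          (-1 : ℝ) ≤ ((2 * (j - k) + 1 : ℤ) : ℝ))
      have h2 : 2 * (j - k) + 1 < 1 := by
        have := hu.2
        rw [hu'] at this
        exact_mod_cast (lt_of_mul_lt_mul_right (by linarith) ha.le :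
          ((2 * (j - k) + 1 : ℤ) : ℝ) < 1)
      have h3 : 2 * (j - k) + 1 = -1 := by omega
      rw [hu', h3]
      simp
  · obtain ⟨k, u, hu, rfl⟩ := exists_eq_add_two_mul ha s
    change (G _).2.1 = 0 ↔ _
    rw [hGg _ u (Ico_subset_Icc_self hu), Prod.smul_snd, Prod.smul_fst,
      smul_eq_zero_iff_right (zpow_ne_zero k (by norm_num)), hQ₂ u hu]
    constructor
    · rintro rfl
      exact ⟨k, by ring⟩
    · rintro ⟨j, hj⟩
      have hu' : u = (2 * (j - k) : ℤ) * a := by push_cast; linarith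
      have h1 : (-1 : ℤ) ≤ 2 * (j - k) := by
        have := hu.1
        rw [hu'] at this
        exact_mod_cast (le_of_mul_le_mul_right (by linarith) ha :
          (-1 : ℝ) ≤ ((2 * (j - k) : ℤ) : ℝ))
      have h2 : 2 * (j - k) < 1 := by
        have := hu.2
        rw [hu'] at this
        exact_mod_cast (lt_of_mul_lt_mul_right (by linarith) ha.le :
          ((2 * (j - k) : ℤ) : ℝ) < 1)
      have h3 : 2 * (j - k) = 0 := by omega
      rw [hu', h3]
      simp
  · rw [hsol.regHam_eq hm.ne' s 0, hz0.1, hz0.2.1, hz0.2.2.1, hz0.2.2.2]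
    exact regHam_binaryCollision hm R

/-! ### Physical time and positions along a symmetric orbit -/

namespace IsSymmetricOrbit

variable {z : PhaseCurve} {m a : ℝ}

theorem x₁_add (h : IsSymmetricOrbit z m a) (s : ℝ) : z.x₁ (s + 2 * a) = z.x₁ s := by
  have := h.antiperiodic s
  simp only [PhaseCurve.state, Prod.neg_mk, Prod.mk.injEq] at this
  simp [PhaseCurve.x₁, this.1, this.2.1]

theorem x₂_add (h : IsSymmetricOrbit z m a) (s : ℝ) : z.x₂ (s + 2 * a) = z.x₂ s := by
  have := h.antiperiodic s
  simp only [PhaseCurve.state, Prod.neg_mk, Prod.mk.injEq] at this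
  simp [PhaseCurve.x₂, this.2.1]

theorem timeRate_add (h : IsSymmetricOrbit z m a) :
    Function.Periodic (fun s => z.Q₁ s ^ 2 * z.Q₂ s ^ 2) (2 * a) := by
  intro s
  have := h.antiperiodic s
  simp only [PhaseCurve.state, Prod.neg_mk, Prod.mk.injEq] at this
  simp [this.1, this.2.1]

theorem timeRate_neg (h : IsSymmetricOrbit z m a) (s : ℝ) :
    z.Q₁ (-s) ^ 2 * z.Q₂ (-s) ^ 2 = z.Q₁ s ^ 2 * z.Q₂ s ^ 2 := by
  have := h.reversible s
  simp only [PhaseCurve.state, reversal, Prod.mk.injEq] at this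
  simp [this.1, this.2.1]

theorem continuous_Q₁ (h : IsSymmetricOrbit z m a) : Continuous z.Q₁ :=
  continuous_iff_continuousAt.2 fun s =>
    (hasDerivWithinAt_univ.1 (h.sol.hQ₁ s (mem_univ s))).continuousAt

theorem continuous_Q₂ (h : IsSymmetricOrbit z m a) : Continuous z.Q₂ :=
  continuous_iff_continuousAt.2 fun s =>
    (hasDerivWithinAt_univ.1 (h.sol.hQ₂ s (mem_univ s))).continuousAt

theorem continuous_timeRate (h : IsSymmetricOrbit z m a) :
    Continuous fun s => z.Q₁ s ^ 2 * z.Q₂ s ^ 2 :=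
  (h.continuous_Q₁.pow 2).mul (h.continuous_Q₂.pow 2)

theorem hasDerivAt_time (h : IsSymmetricOrbit z m a) (s : ℝ) :
    HasDerivAt z.time (z.Q₁ s ^ 2 * z.Q₂ s ^ 2) s :=
  intervalIntegral.integral_hasDerivAt_right (h.continuous_timeRate.intervalIntegrable _ _)
    (h.continuous_timeRate.stronglyMeasurableAtFilter _ _) h.continuous_timeRate.continuousAt

theorem continuous_time (h : IsSymmetricOrbit z m a) : Continuous z.time :=
  continuous_iff_continuousAt.2 fun s => (h.hasDerivAt_time s).continuousAt

theorem time_sub (h : IsSymmetricOrbit z m a) (s t : ℝ) :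
    z.time t - z.time s = ∫ σ in s..t, z.Q₁ σ ^ 2 * z.Q₂ σ ^ 2 :=
  intervalIntegral.integral_interval_sub_left (h.continuous_timeRate.intervalIntegrable _ _)
    (h.continuous_timeRate.intervalIntegrable _ _)

theorem exists_int_mul_of_eq_zero (h : IsSymmetricOrbit z m a) {s : ℝ}
    (hs : z.Q₁ s ^ 2 * z.Q₂ s ^ 2 = 0) : ∃ k : ℤ, s = k * a := by
  rcases mul_eq_zero.1 hs with h' | h'
  · obtain ⟨k, hk⟩ := (h.Q₁_eq_zero_iff s).1 (pow_eq_zero_iff two_ne_zero |>.1 h')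
    exact ⟨2 * k + 1, by push_cast; exact hk⟩
  · obtain ⟨k, hk⟩ := (h.Q₂_eq_zero_iff s).1 (pow_eq_zero_iff two_ne_zero |>.1 h')
    exact ⟨2 * k, by push_cast; exact hk⟩

/-- The rate is nonnegative and can vanish only at integer multiples of `a`, hence on no nontrivial
interval. -/
theorem strictMono_time (h : IsSymmetricOrbit z m a) (ha : 0 < a) : StrictMono z.time := by
  intro s t hst
  rw [← sub_pos, h.time_sub]
  refine intervalIntegral.integral_pos hst h.continuous_timeRate.continuousOn
    (fun x _ => by positivity) ?_
  by_contra! hcon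
  have hzero : ∀ x ∈ Icc s t, ∃ k : ℤ, x = k * a := fun x hx =>
    h.exists_int_mul_of_eq_zero (le_antisymm (hcon x hx) (by positivity))
  obtain ⟨k, hk⟩ := hzero s ⟨le_rfl, hst.le⟩
  -- A second point of [s, t] at distance less than `a` from `s` cannot also be a multiple of `a`.
  have hpos : 0 < min (t - s) (a / 2) := lt_min (by linarith) (by linarith)
  obtain ⟨j, hj⟩ := hzero (s + min (t - s) (a / 2))
    ⟨by linarith, by linarith [min_le_left (t - s) (a / 2)]⟩
  have hd : min (t - s) (a / 2) = ((j - k : ℤ) : ℝ) * a := by push_cast; linarith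
  have h1 : (0 : ℝ) < ((j - k : ℤ) : ℝ) := by
    rw [hd] at hpos
    exact pos_of_mul_pos_left hpos ha.le
  have h2 : ((j - k : ℤ) : ℝ) < 1 := by
    refine lt_of_mul_lt_mul_right ?_ ha.le
    rw [← hd]
    linarith [min_le_right (t - s) (a / 2)]
  norm_cast at h1 h2
  omega

theorem time_zero (z : PhaseCurve) : z.time 0 = 0 := by simp [PhaseCurve.time]

theorem time_neg (h : IsSymmetricOrbit z m a) (s : ℝ) : z.time (-s) = -z.time s := by
  have := intervalIntegral.integral_comp_neg (fun σ => z.Q₁ σ ^ 2 * z.Q₂ σ ^ 2) (a := 0) (b := s)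
  simp only [h.timeRate_neg, neg_zero] at this
  rw [PhaseCurve.time, PhaseCurve.time, this, intervalIntegral.integral_symm]

/-- The integral of a periodic rate over a full period may be taken over [-a, a], where oddness of
`time` evaluates it. -/
theorem time_add (h : IsSymmetricOrbit z m a) (s : ℝ) :
    z.time (s + 2 * a) = z.time s + 2 * z.time a := by
  have h1 := h.time_sub s (s + 2 * a)
  have h2 := h.time_sub (-a) (-a + 2 * a)
  rw [h.timeRate_add.intervalIntegral_add_eq s (-a), ← h2, h.time_neg,
    show -a + 2 * a = a by ring] at h1
  linarith

theorem time_add_int_mul (h : IsSymmetricOrbit z m a) (s : ℝ) (k : ℤ) :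
    z.time (s + 2 * k * a) = z.time s + k * (2 * z.time a) := by
  induction k with
  | zero => simp
  | succ i ih =>
    rw [show s + 2 * ((i + 1 : ℤ) : ℝ) * a = s + 2 * (i : ℤ) * a + 2 * a by push_cast; ring,
      h.time_add, ih]
    push_cast
    ring
  | pred i ih =>
    have := h.time_add (s + 2 * ((-i - 1 : ℤ) : ℝ) * a)
    rw [show s + 2 * ((-i - 1 : ℤ) : ℝ) * a + 2 * a = s + 2 * (-i : ℤ) * a by push_cast; ring,
      ih] at this
    push_cast at this ⊢
    linarith

theorem time_pos (h : IsSymmetricOrbit z m a) (ha : 0 < a) : 0 < z.time a := by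
  simpa [time_zero] using h.strictMono_time ha ha

theorem surjective_time (h : IsSymmetricOrbit z m a) (ha : 0 < a) :
    Function.Surjective z.time := by
  intro t
  have hT := h.time_pos ha
  obtain ⟨n, hn⟩ := exists_nat_gt (|t| / (2 * z.time a))
  rw [div_lt_iff₀ (by positivity)] at hn
  refine mem_range_of_exists_le_of_exists_ge h.continuous_time
    ⟨0 + 2 * ((-n : ℤ) : ℝ) * a, ?_⟩ ⟨0 + 2 * ((n : ℤ) : ℝ) * a, ?_⟩
  · rw [h.time_add_int_mul, time_zero]
    push_cast
    linarith [neg_abs_le t]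
  · rw [h.time_add_int_mul, time_zero]
    push_cast
    linarith [le_abs_self t]

theorem isBC_iff (h : IsSymmetricOrbit z m a) (s : ℝ) :
    IsBC (z.x₁ s) (z.x₂ s) ↔ ∃ k : ℤ, s = 2 * k * a := by
  rw [← h.Q₂_eq_zero_iff]
  have hd := h.sol.mem_domain s (mem_univ s)
  constructor
  · rintro ⟨h1, -⟩
    simpa [PhaseCurve.x₂] using h1
  · intro h1
    have : z.Q₁ s ≠ 0 := by simpa [h1] using hd
    refine ⟨by simp [PhaseCurve.x₂, h1], ?_⟩
    unfold PhaseCurve.x₁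
    positivity

theorem isSBC_iff (h : IsSymmetricOrbit z m a) (s : ℝ) :
    IsSBC (z.x₁ s) (z.x₂ s) ↔ ∃ k : ℤ, s = (2 * k + 1) * a := by
  rw [← h.Q₁_eq_zero_iff]
  have hd := h.sol.mem_domain s (mem_univ s)
  constructor
  · rintro ⟨h1, -⟩
    simpa [PhaseCurve.x₁, PhaseCurve.x₂] using h1
  · intro h1
    have : z.Q₂ s ≠ 0 := by simpa [h1] using hd
    refine ⟨by simp [PhaseCurve.x₁, PhaseCurve.x₂, h1], ?_⟩
    unfold PhaseCurve.x₂
    positivity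

/-- A shorter period would carry the zero of Q₂ at 0 to another one, leaving only 2a; there
antiperiodicity would force Q₁(0) = 0. -/
theorem hasLeastPeriod_state (h : IsSymmetricOrbit z m a) (ha : 0 < a) :
    HasLeastPeriod z.state (4 * a) := by
  refine ⟨by positivity, fun s => ?_, fun T' h0 h4 hper => ?_⟩
  · rw [show s + 4 * a = s + 2 * a + 2 * a by ring, h.antiperiodic, h.antiperiodic, neg_neg]
  · have hT := hper 0
    rw [zero_add] at hT
    have hQ₁ : z.Q₁ 0 ≠ 0 := by
      intro h'
      obtain ⟨k, hk⟩ := (h.Q₁_eq_zero_iff 0).1 h'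
      rcases mul_eq_zero.1 hk.symm with h' | h'
      · norm_cast at h'
        omega
      · exact ha.ne' h'
    have hQ₂ : z.Q₂ T' = 0 := by
      rw [show z.Q₂ T' = z.Q₂ 0 from congrArg (fun p => p.2.1) hT]
      exact (h.Q₂_eq_zero_iff 0).2 ⟨0, by simp⟩
    obtain ⟨k, rfl⟩ := (h.Q₂_eq_zero_iff T').1 hQ₂
    have h1 : (0 : ℝ) < k := by
      have := pos_of_mul_pos_left h0 ha.le
      linarith
    have h2 : (k : ℝ) < 2 := by
      have := lt_of_mul_lt_mul_right h4 ha.le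
      linarith
    norm_cast at h1 h2
    obtain rfl : k = 1 := by omega
    have hanti := h.antiperiodic 0
    rw [zero_add] at hanti
    rw [Int.cast_one, mul_one, hanti] at hT
    have := congrArg Prod.fst hT
    simp only [PhaseCurve.state, Prod.fst_neg] at this
    exact hQ₁ (by linarith)

/-- Along a symmetric regularized periodic orbit, the bodies move, in physical time, on a
Schubart-like orbit. -/
theorem exists_isSchubartLike (h : IsSymmetricOrbit z m a) (hm : m ≠ 0) (ha : 0 < a) :
    ∃ X₁ X₂ : ℝ → ℝ, (∀ s, X₁ (z.time s) = z.x₁ s ∧ X₂ (z.time s) = z.x₂ s) ∧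
      IsSchubartLike m X₁ X₂ (2 * z.time a) 0 (z.time a) := by
  -- As an order isomorphism, `time` has a continuous inverse even at collisions, where its
  -- derivative vanishes.
  set e := (h.strictMono_time ha).orderIsoOfSurjective z.time (h.surjective_time ha)
  have he : ∀ s, e.symm (z.time s) = s := e.symm_apply_apply
  have he' : ∀ t, z.time (e.symm t) = t := e.apply_symm_apply
  have hec : Continuous e.symm := e.symm.continuous
  have hx₁ : Continuous z.x₁ := ((h.continuous_Q₁.pow 2).add ((h.continuous_Q₂.pow 2).div_const 2))
  have hx₂ : Continuous z.x₂ := (h.continuous_Q₂.pow 2).div_const 2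
  have hτ : ∀ t, 0 < z.x₂ (e.symm t) → z.x₂ (e.symm t) < z.x₁ (e.symm t) →
      z.Q₁ (e.symm t) ≠ 0 ∧ z.Q₂ (e.symm t) ≠ 0 ∧
        HasDerivAt e.symm (z.Q₁ (e.symm t) ^ 2 * z.Q₂ (e.symm t) ^ 2)⁻¹ t := by
    intro t h1 h2
    have hQ₂ : z.Q₂ (e.symm t) ≠ 0 := by
      intro h'
      simp [PhaseCurve.x₂, h'] at h1
    have hQ₁ : z.Q₁ (e.symm t) ≠ 0 := by
      intro h'
      simp [PhaseCurve.x₁, PhaseCurve.x₂, h'] at h2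
    exact ⟨hQ₁, hQ₂, HasDerivAt.of_local_left_inverse hec.continuousAt
      (h.hasDerivAt_time (e.symm t)) (by positivity) (Eventually.of_forall he')⟩
  have hd₁ : ∀ t, 0 < z.x₂ (e.symm t) → z.x₂ (e.symm t) < z.x₁ (e.symm t) →
      HasDerivAt (fun t => z.x₁ (e.symm t)) (z.v₁ (e.symm t)) t := by
    intro t h1 h2
    obtain ⟨hQ₁, hQ₂, hd⟩ := hτ t h1 h2
    refine ((h.sol.hasDerivAt_x₁ hm (e.symm t)).comp t hd).congr_deriv ?_
    simp only [PhaseCurve.v₁]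
    field_simp
  have hd₂ : ∀ t, 0 < z.x₂ (e.symm t) → z.x₂ (e.symm t) < z.x₁ (e.symm t) →
      HasDerivAt (fun t => z.x₂ (e.symm t)) (z.v₂ m (e.symm t)) t := by
    intro t h1 h2
    obtain ⟨hQ₁, hQ₂, hd⟩ := hτ t h1 h2
    refine ((h.sol.hasDerivAt_x₂ hm (e.symm t)).comp t hd).congr_deriv ?_
    simp only [PhaseCurve.v₂]
    field_simp
    ring
  -- Being away from collisions is an open condition, so the velocity formulas hold near `t` and can
  -- be differentiated again.
  have hev : ∀ t, 0 < z.x₂ (e.symm t) → z.x₂ (e.symm t) < z.x₁ (e.symm t) →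
      ∀ᶠ t' in 𝓝 t, 0 < z.x₂ (e.symm t') ∧ z.x₂ (e.symm t') < z.x₁ (e.symm t') :=
    fun t h1 h2 => (((hx₂.comp hec).tendsto t).eventually_const_lt h1).and
      (((hx₂.comp hec).tendsto t).eventually_lt ((hx₁.comp hec).tendsto t) h2)
  have hbc : ∀ t, IsBC (z.x₁ (e.symm t)) (z.x₂ (e.symm t)) ↔
      ∃ k : ℤ, t = 0 + k * (2 * z.time a) := by
    intro t
    rw [h.isBC_iff]
    refine exists_congr fun k => ?_
    rw [e.symm_apply_eq, ← time_zero z, ← h.time_add_int_mul, zero_add]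
    rfl
  have hsbc : ∀ t, IsSBC (z.x₁ (e.symm t)) (z.x₂ (e.symm t)) ↔
      ∃ k : ℤ, t = z.time a + k * (2 * z.time a) := by
    intro t
    rw [h.isSBC_iff]
    refine exists_congr fun k => ?_
    rw [e.symm_apply_eq, ← h.time_add_int_mul, show a + 2 * k * a = (2 * k + 1) * a by ring]
    rfl
  have hT := h.time_pos ha
  refine ⟨fun t => z.x₁ (e.symm t), fun t => z.x₂ (e.symm t), fun s => by simp only [he, and_self],
    hx₁.comp hec, hx₂.comp hec, fun t => ?_, ⟨by positivity, fun t => ?_, fun T' h0 h1 hper => ?_⟩,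
    fun t h1 h2 => ⟨(hd₁ t h1 h2).differentiableAt, (hd₂ t h1 h2).differentiableAt⟩,
    fun t h1 h2 => ?_, fun t h1 h2 => ?_, fun t h1 h2 => ?_, hbc, hsbc, hT, by linarith⟩
  · have hd := sq_add_sq_ne_zero (h.sol.mem_domain (e.symm t) (mem_univ _))
    refine ⟨by unfold PhaseCurve.x₂; positivity, ?_, ?_⟩
    · simp only [PhaseCurve.x₁, PhaseCurve.x₂]
      nlinarith [sq_nonneg (z.Q₁ (e.symm t))]
    · have : 0 < z.Q₁ (e.symm t) ^ 2 + z.Q₂ (e.symm t) ^ 2 := lt_of_le_of_ne (by positivity) hd.symm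
      simp only [PhaseCurve.x₁]
      nlinarith [sq_nonneg (z.Q₁ (e.symm t))]
  · have : e.symm (t + 2 * z.time a) = e.symm t + 2 * a := by
      rw [e.symm_apply_eq]
      change _ = z.time _
      rw [h.time_add, he']
    simp only [this, h.x₁_add, h.x₂_add]
  -- A period carries the binary collision at time 0 to another one, so it is an integer multiple of
  -- 2 t(a).
  · have h2 := hper 0
    simp only [zero_add, Prod.mk.injEq] at h2
    have h3 := (hbc 0).2 ⟨0, by simp⟩
    rw [← h2.1, ← h2.2, hbc] at h3
    obtain ⟨k, hk⟩ := h3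
    rw [zero_add] at hk
    rw [hk] at h0 h1
    have h4 : (0 : ℝ) < k := pos_of_mul_pos_left h0 (by positivity)
    have h5 : (k : ℝ) < 1 := lt_of_mul_lt_mul_right (by linarith) (by positivity : 0 ≤ 2 * z.time a)
    norm_cast at h4 h5
    omega
  · obtain ⟨hQ₁, hQ₂, hd⟩ := hτ t h1 h2
    refine (((h.sol.hasDerivAt_v₁ hm (h.level _) hQ₁).comp t hd).congr_deriv
      (mul_inv_cancel_right₀ (by positivity) _)).congr_of_eventuallyEq ?_
    filter_upwards [hev t h1 h2] with t' ht'
    exact (hd₁ t' ht'.1 ht'.2).deriv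
  · obtain ⟨hQ₁, hQ₂, hd⟩ := hτ t h1 h2
    refine (((h.sol.hasDerivAt_v₂ hm (h.level _) hQ₁ hQ₂).comp t hd).congr_deriv
      (mul_inv_cancel_right₀ (by positivity) _)).congr_of_eventuallyEq ?_
    filter_upwards [hev t h1 h2] with t' ht'
    exact (hd₂ t' ht'.1 ht'.2).deriv
  · obtain ⟨hQ₁, hQ₂, -⟩ := hτ t h1 h2
    rw [(hd₁ t h1 h2).deriv, (hd₂ t h1 h2).deriv]
    exact PhaseCurve.energy_eq hm (h.level _) hQ₁ hQ₂

end IsSymmetricOrbit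

end CollinearFourBody

end

/-! ### The main theorem -/

theorem theorem4 (m R s₁ : ℝ) (hm : 0 < m) (hR : 0 < R) (hs₁ : 0 < s₁)
    -- a solution up to regularized time `s₁`, starting at a binary collision
    (y : CollinearFourBody.PhaseCurve)
    (hy : y.IsSolutionOn m (Set.Icc 0 s₁)) (hy0 : y.StartsAtBC m R)
    -- `s₁` is the time of the first simultaneous binary collision, and there is no other
    -- binary collision before it
    (hsbc : y.Q₁ s₁ = 0) (hfirst : ∀ s ∈ Set.Ico 0 s₁, y.Q₁ s ≠ 0)
    (hnobc : ∀ s ∈ Set.Ioc 0 s₁, 0 < y.Q₂ s)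
    -- the net momentum of the clusters vanishes at `s₁`
    (hP₂ : y.P₂ s₁ = 0) :
    ∃ z : CollinearFourBody.PhaseCurve,
      -- the regularized solution exists for all times and is unique
      z.IsSolutionOn m Set.univ ∧ z.StartsAtBC m R ∧
      (∀ (I : Set ℝ) (w : CollinearFourBody.PhaseCurve), I.OrdConnected → (0 : ℝ) ∈ I →
        w.IsSolutionOn m I → w.StartsAtBC m R → Set.EqOn w.state z.state I) ∧
      -- it is periodic, with least period `4 s₁`
      CollinearFourBody.HasLeastPeriod z.state (4 * s₁) ∧
      -- the two kinds of collision alternate along it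
      (∀ s, CollinearFourBody.IsBC (z.x₁ s) (z.x₂ s) ↔ ∃ k : ℤ, s = 2 * k * s₁) ∧
      (∀ s, CollinearFourBody.IsSBC (z.x₁ s) (z.x₂ s) ↔ ∃ k : ℤ, s = (2 * k + 1) * s₁) ∧
      -- in physical time, it is a Schubart-like periodic orbit of the four bodies
      StrictMono z.time ∧ Function.Surjective z.time ∧
      ∃ X₁ X₂ : ℝ → ℝ, (∀ s, X₁ (z.time s) = z.x₁ s ∧ X₂ (z.time s) = z.x₂ s) ∧
        CollinearFourBody.IsSchubartLike m X₁ X₂ (2 * z.time s₁) 0 (z.time s₁) := by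
  obtain ⟨z, hz0, h⟩ :=
    CollinearFourBody.exists_isSymmetricOrbit hm hs₁ hy hy0 hsbc hfirst hnobc hP₂
  refine ⟨z, h.sol, hz0, fun I w hI hI0 hw hw0 => ?_, h.hasLeastPeriod_state hs₁, h.isBC_iff,
    h.isSBC_iff, h.strictMono_time hs₁, h.surjective_time hs₁,
    h.exists_isSchubartLike hm.ne' hs₁⟩
  obtain ⟨a1, a2, a3, a4⟩ := hw0
  obtain ⟨b1, b2, b3, b4⟩ := hz0
  refine CollinearFourBody.eqOn_of_locallyLipschitzOn
    (CollinearFourBody.locallyLipschitzOn_regField m) hI hI0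
    ((CollinearFourBody.PhaseCurve.isSolutionOn_iff hm.ne' w I).1 hw)
    (fun s _ => ?_) (by simp [CollinearFourBody.PhaseCurve.state, *])
  have := (CollinearFourBody.PhaseCurve.isSolutionOn_iff hm.ne' z univ).1 h.sol s (mem_univ s)
  exact ⟨this.1, this.2.mono (subset_univ I)⟩
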